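/- A Dyck path of semilength $n$ is a lattice path from $(0,0)$ to $(n,n)$ consisting of $n$ north steps $N=(0,1)$ and $n$ east steps $E=(1,0)$ that never goes below the line $y=x$. A parking function of size $n$ is a Dyck path of semilength $n$ whose north steps are labeled with the distinct integers $1,\dots,n$ so that the labels of any two immediately consecutive north steps increase along the path. Reading the labels of the north steps of a parking function $p$ in order along the path gives a permutation $\phi(p)$ of $\{1,\dots,n\}$. For permutations $\rho_1,\dots,\rho_m$, let $\mathrm{pf}_n(\rho_1,\dots,\rho_m)$ be the number of parking functions $p$ of size $n$ such that $\phi(p)$ avoids each of the patterns $\rho_1,\dots,\rho_m$ (i.e. has no subsequence order-isomorphic to any $\rho_j$). Then for every $n\ge 1$, $$\mathrm{pf}_n(213,312)=\sum_{k=0}^{n-1}\sum_{i=0}^{k}\binom{n-1}{i}\cdot\frac{(k+1)\binom{2n-2-k}{n-1-k}}{n}.$$ Moreover, call a north step of a Dyck path single if it is neither immediately preceded nor immediately followed by a north step. For $0\le k\le n-1$, let $d(n,k)$ be the number of Dyck paths of semilength $n$ for which $k$ is the largest integer with $k\le n-1$ such that the final $k$ north steps of the path are all single (so the initial north step of the path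 is never counted, and $(NE)^n$ has $k=n-1$). Then $$d(n,k)=\frac{(k+1)\binom{2n-2-k}{n-1-k}}{n}.$$ -/

import Mathlib

/-- A permutation `π` of length `n` contains the pattern `ρ` of length `m` if there are positions
`f 0 < f 1 < ⋯ < f (m - 1)` at which the entries of `π` are order-isomorphic to `ρ`. Permutations
of length `n` are permutations of `Fin n = {0, …, n - 1}` (positions and values shifted by one). -/
def ContainsPattern {n m : ℕ} (π : Equiv.Perm (Fin n)) (ρ : Equiv.Perm (Fin m)) : Prop :=
  ∃ f : Fin m → Fin n, StrictMono f ∧ ∀ a b : Fin m, π (f a) ≤ π (f b) ↔ ρ a ≤ ρ b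

/-- A permutation avoids a pattern if it does not contain it. -/
def AvoidsPattern {n m : ℕ} (π : Equiv.Perm (Fin n)) (ρ : Equiv.Perm (Fin m)) : Prop :=
  ¬ ContainsPattern π ρ

/-- The pattern 213, in values shifted by one: `0 ↦ 1`, `1 ↦ 0`, `2 ↦ 2`. -/
def pattern213 : Equiv.Perm (Fin 3) where
  toFun := ![1, 0, 2]
  invFun := ![1, 0, 2]
  left_inv := by decide
  right_inv := by decide

/-- The pattern 312, in values shifted by one: `0 ↦ 2`, `1 ↦ 0`, `2 ↦ 1`. -/
def pattern312 : Equiv.Perm (Fin 3) where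
  toFun := ![2, 0, 1]
  invFun := ![1, 2, 0]
  left_inv := by decide
  right_inv := by decide

/-- A parking function of size `n` as a labeled Dyck path: a Dyck path of semilength `n` (Mathlib's
`DyckWord`; `DyckStep.U` is a north step and `DyckStep.D` an east step) together with a labeling of
its north steps, in their order along the path, by the permutation `label`, such that the labels of
two north steps that follow each other immediately in the path increase. -/
structure LabeledDyckPath (n : ℕ) where
  /-- the underlying Dyck path -/
  path : DyckWord
  /-- the path goes from `(0, 0)` to `(n, n)` -/
  semilength_path : path.semilength = n
  /-- `label a` is the label of the `a`-th north step (counted from zero); thus `label` is also the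
  permutation obtained by reading the labels of the north steps in order -/
  label : Equiv.Perm (Fin n)
  /-- if the steps in places `j` and `j + 1` of the path are both north, and they are the north steps
  number `a` and `b`, then the label of the first is less than the label of the second -/
  label_lt : ∀ (j : ℕ) (a b : Fin n),
    path.toList[j]? = some DyckStep.U → path.toList[j + 1]? = some DyckStep.U →
    (path.toList.take j).count DyckStep.U = (a : ℕ) →
    (path.toList.take (j + 1)).count DyckStep.U = (b : ℕ) →
    label a < label b

/-- `pf n P` is the number of parking functions of size `n` whose permutation avoids all the
patterns (of length `m`) in `P`. -/
noncomputable def pf {m : ℕ} (n : ℕ) (P : Set (Equiv.Perm (Fin m))) : ℕ :=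
  Nat.card {p : LabeledDyckPath n // ∀ ρ ∈ P, AvoidsPattern p.label ρ}

/-- The step in place `j` of the Dyck path is a single north step: it is a north step, and neither
the step right after it nor the step right before it (if there is one) is a north step. -/
def IsSingleNorthStep (p : DyckWord) (j : ℕ) : Prop :=
  p.toList[j]? = some DyckStep.U ∧ p.toList[j + 1]? ≠ some DyckStep.U ∧
    ∀ i : ℕ, i + 1 = j → p.toList[i]? ≠ some DyckStep.U

/-- The final `k` north steps of the Dyck path (those preceded by at least `p.semilength - k`
north steps) are all single north steps. -/
def FinalNorthStepsSingle (p : DyckWord) (k : ℕ) : Prop :=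
  ∀ j : ℕ, p.toList[j]? = some DyckStep.U →
    p.semilength ≤ (p.toList.take j).count DyckStep.U + k → IsSingleNorthStep p j

/-- The number of Dyck paths of semilength `n` that end in exactly `k` single north steps: `k` is
the greatest number such that the final `k` north steps are single. The initial north step of a
path is never counted (hence `l < n`); this only matters for the path `(NE)^n`, all of whose north
steps are single, and which is counted for `k = n - 1`. -/
noncomputable def numDyckFinalSingles (n k : ℕ) : ℕ :=
  Nat.card {p : DyckWord // p.semilength = n ∧
    IsGreatest {l : ℕ | l < n ∧ FinalNorthStepsSingle p l} k}

/-! A permutation avoids 213 and 312 exactly when no entry has larger entries on both sides, i.e.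
when it is unimodal. One peaking at position `i` of `Fin (m + 1)` is fixed by the set of values left
of the peak, whence `m.choose i` of them (`card_isUnimodalAt`). Such a labeling fits a Dyck path
exactly when no two adjacent north steps lie on its descending part, i.e. when the last `m - i`
north steps are single (`increasesOnRuns_iff`).

So `pf` is a sum of binomials times the numbers of paths whose last `i` north steps are single;
these are tail sums of `numDyckFinalSingles`, and exchanging the sums gives the first formula.
Building words from the right counts the paths by Pascal-type recursions: for semilength `n` there
are `C(2n-1-l, n) - C(2n-1-l, n+1)` with the last `l` single. Differences in `l` give the second
formula. -/

namespace DyckStep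

instance : Finite DyckStep :=
  Finite.of_injective (fun s : DyckStep => decide (s = U)) fun a b => by cases a <;> cases b <;> simp

end DyckStep

open DyckStep in
/-- Every suffix of the list has at most as many `U`s as `D`s, and no `U` that is followed by at
most `l` further `U`s is immediately followed by a `U`. -/
def IsSparseSuffix (l : ℕ) : List DyckStep → Prop
  | [] => True
  | s :: t => IsSparseSuffix l t ∧ (s :: t).count U ≤ (s :: t).count D ∧
      (s = U → t[0]? = some U → l < t.count U)

/-- The lists satisfying `IsSparseSuffix l` with `u` letters `U` and `d` letters `D`. -/
def sparseSuffixes (l u d : ℕ) : Set (List DyckStep) :=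
  {L | IsSparseSuffix l L ∧ L.count DyckStep.U = u ∧ L.count DyckStep.D = d}

namespace IsSparseSuffix

open DyckStep

theorem count_le {l : ℕ} {L : List DyckStep} (h : IsSparseSuffix l L) :
    L.count U ≤ L.count D := by
  cases L with
  | nil => simp
  | cons s t => exact h.2.1

theorem iff_drop (l : ℕ) (L : List DyckStep) :
    IsSparseSuffix l L ↔ (∀ i, (L.drop i).count U ≤ (L.drop i).count D) ∧
      ∀ j, L[j]? = some U → L[j + 1]? = some U → l < (L.drop (j + 1)).count U := by
  induction L with
  | nil => simp [IsSparseSuffix]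
  | cons s t ih =>
    rw [IsSparseSuffix, ih]
    constructor
    · rintro ⟨⟨h1, h2⟩, h3, h4⟩
      refine ⟨fun i => ?_, fun j => ?_⟩
      · cases i with
        | zero => exact h3
        | succ i => exact h1 i
      · cases j with
        | zero => simpa using h4
        | succ j => simpa using h2 j
    · rintro ⟨h1, h2⟩
      refine ⟨⟨fun i => h1 (i + 1), fun j => by simpa using h2 (j + 1)⟩, h1 0, ?_⟩
      simpa using h2 0

end IsSparseSuffix

/-! ### Counting sparse suffixes by recursion on the first letter -/

section Counting

open DyckStep

theorem length_eq_count_add_count (L : List DyckStep) : L.length = L.count U + L.count D := by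
  induction L with
  | nil => simp
  | cons s t ih => cases s <;> simp [ih] <;> omega

theorem finite_sparseSuffixes (l u d : ℕ) : (sparseSuffixes l u d).Finite := by
  refine (List.finite_length_eq DyckStep (u + d)).subset ?_
  rintro L ⟨-, rfl, rfl⟩
  exact length_eq_count_add_count L

theorem sparseSuffixes_eq_empty {l u d : ℕ} (h : d < u) : sparseSuffixes l u d = ∅ := by
  rw [Set.eq_empty_iff_forall_notMem]
  rintro L ⟨hL, rfl, rfl⟩
  exact absurd hL.count_le (by omega)

theorem sparseSuffixes_zero_succ (l d : ℕ) :
    sparseSuffixes l 0 (d + 1) = List.cons D '' sparseSuffixes l 0 d := by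
  ext L
  constructor
  · rintro ⟨hL, hu, hd⟩
    cases L with
    | nil => simp at hd
    | cons s t =>
      cases s with
      | U => simp at hu
      | D => exact ⟨t, ⟨hL.1, by simpa using hu, by simpa using hd⟩, rfl⟩
  · rintro ⟨t, ⟨ht, hu, hd⟩, rfl⟩
    exact ⟨⟨ht, by simp [hu], by simp⟩, by simpa using hu, by simpa using hd⟩

theorem sparseSuffixes_succ_succ_of_lt {l u d : ℕ} (hud : u ≤ d) (hl : l < u) :
    sparseSuffixes l (u + 1) (d + 1) =
      List.cons U '' sparseSuffixes l u (d + 1) ∪ List.cons D '' sparseSuffixes l (u + 1) d := by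
  ext L
  constructor
  · rintro ⟨hL, hu, hd⟩
    cases L with
    | nil => simp at hd
    | cons s t =>
      cases s with
      | U => exact .inl ⟨t, ⟨hL.1, by simpa using hu, by simpa using hd⟩, rfl⟩
      | D => exact .inr ⟨t, ⟨hL.1, by simpa using hu, by simpa using hd⟩, rfl⟩
  · rintro (⟨t, ⟨ht, hu, hd⟩, rfl⟩ | ⟨t, ⟨ht, hu, hd⟩, rfl⟩)
    · exact ⟨⟨ht, by simp [hu, hd, hud], fun _ _ => by omega⟩, by simpa using hu, by simpa using hd⟩
    · exact ⟨⟨ht, by simp [hu, hd, hud], by simp⟩, by simpa using hu, by simpa using hd⟩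

theorem sparseSuffixes_succ_succ_of_le {l u d : ℕ} (hud : u ≤ d) (hl : u ≤ l) :
    sparseSuffixes l (u + 1) (d + 1) =
      (fun t => U :: D :: t) '' sparseSuffixes l u d ∪
        List.cons D '' sparseSuffixes l (u + 1) d := by
  ext L
  constructor
  · rintro ⟨hL, hu, hd⟩
    cases L with
    | nil => simp at hd
    | cons s t =>
      cases s with
      | U =>
        cases t with
        | nil => simp at hd
        | cons s t =>
          cases s with
          | U =>
            have h := hL.2.2 rfl rfl
            simp at h hu
            omega
          | D => exact .inl ⟨t, ⟨hL.1.1, by simpa using hu, by simpa using hd⟩, rfl⟩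
      | D => exact .inr ⟨t, ⟨hL.1, by simpa using hu, by simpa using hd⟩, rfl⟩
  · rintro (⟨t, ⟨ht, hu, hd⟩, rfl⟩ | ⟨t, ⟨ht, hu, hd⟩, rfl⟩)
    · refine ⟨⟨⟨ht, ?_, by simp⟩, by simp [hu, hd, hud], by simp⟩,
        by simpa using hu, by simpa using hd⟩
      simp [hu, hd]
      omega
    · exact ⟨⟨ht, by simp [hu, hd, hud], by simp⟩, by simpa using hu, by simpa using hd⟩

theorem ncard_sparseSuffixes_zero (l d : ℕ) : (sparseSuffixes l 0 d).ncard = 1 := by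
  induction d with
  | zero =>
    have : sparseSuffixes l 0 0 = {[]} := by
      ext L
      constructor
      · rintro ⟨-, hu, hd⟩
        exact List.eq_nil_of_length_eq_zero (by rw [length_eq_count_add_count, hu, hd])
      · rintro rfl
        simp [sparseSuffixes, IsSparseSuffix]
    rw [this, Set.ncard_singleton]
  | succ d ih =>
    rw [sparseSuffixes_zero_succ, Set.ncard_image_of_injective _ List.cons_injective, ih]

theorem ncard_sparseSuffixes_succ_succ_of_lt {l u d : ℕ} (hud : u ≤ d) (hl : l < u) :
    (sparseSuffixes l (u + 1) (d + 1)).ncard =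
      (sparseSuffixes l u (d + 1)).ncard + (sparseSuffixes l (u + 1) d).ncard := by
  rw [sparseSuffixes_succ_succ_of_lt hud hl, Set.ncard_union_eq _
    ((finite_sparseSuffixes _ _ _).image _) ((finite_sparseSuffixes _ _ _).image _),
    Set.ncard_image_of_injective _ List.cons_injective,
    Set.ncard_image_of_injective _ List.cons_injective]
  rw [Set.disjoint_left]
  rintro _ ⟨t, -, rfl⟩ ⟨t', -, h⟩
  simp at h

theorem ncard_sparseSuffixes_succ_succ_of_le {l u d : ℕ} (hud : u ≤ d) (hl : u ≤ l) :
    (sparseSuffixes l (u + 1) (d + 1)).ncard =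
      (sparseSuffixes l u d).ncard + (sparseSuffixes l (u + 1) d).ncard := by
  rw [sparseSuffixes_succ_succ_of_le hud hl, Set.ncard_union_eq _
    ((finite_sparseSuffixes _ _ _).image _) ((finite_sparseSuffixes _ _ _).image _),
    Set.ncard_image_of_injective _ (fun a b h => by simpa using h),
    Set.ncard_image_of_injective _ List.cons_injective]
  rw [Set.disjoint_left]
  rintro _ ⟨t, -, rfl⟩ ⟨t', -, h⟩
  simp at h

/-- With at most `l + 1` letters `U`, every `U` is immediately followed by a `D`, so a word is an
arrangement of `u` blocks `UD` and `d - u` letters `D`; the suffix condition is then automatic. -/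
theorem ncard_sparseSuffixes_of_le {l u : ℕ} (hu : u ≤ l + 1) (d : ℕ) :
    (sparseSuffixes l u d).ncard = d.choose u := by
  induction d generalizing u with
  | zero =>
    cases u with
    | zero => simp [ncard_sparseSuffixes_zero]
    | succ u => simp [sparseSuffixes_eq_empty]
  | succ d ih =>
    cases u with
    | zero => simp [ncard_sparseSuffixes_zero]
    | succ u =>
      rcases le_or_gt u d with h | h
      · rw [ncard_sparseSuffixes_succ_succ_of_le h (by omega), ih (by omega), ih hu,
          Nat.choose_succ_succ]
      · rw [sparseSuffixes_eq_empty (by omega), Nat.choose_eq_zero_of_lt (by omega),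
          Set.ncard_empty]

/-- A ballot-type difference of binomials, with `u = l + 1 + v` and `d = l + v + e`. Both sides obey
Pascal's rule; the boundaries are `v = 0`, the block count above, and `e = 0`, where `d < u` and the
two binomials coincide. -/
theorem ncard_sparseSuffixes_add_choose (l v e : ℕ) :
    (sparseSuffixes l (l + 1 + v) (l + v + e)).ncard + (v + (l + v + e)).choose (l + v + e + 1) =
      (v + (l + v + e)).choose (l + 1 + v) := by
  induction v generalizing e with
  | zero =>
    rw [ncard_sparseSuffixes_of_le le_rfl, Nat.choose_eq_zero_of_lt (by omega : 0 + (l + 0 + e) < _)]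
    simp
  | succ v ihv =>
    induction e with
    | zero =>
      rw [sparseSuffixes_eq_empty (by omega), Set.ncard_empty, zero_add]
      congr 1
      omega
    | succ e ihe =>
      have h1 := ihv (e + 2)
      have h := ncard_sparseSuffixes_succ_succ_of_lt (l := l) (u := l + 1 + v)
        (d := l + (v + 1) + e) (by omega) (by omega)
      have c1 := Nat.choose_succ_succ (v + 1 + (l + (v + 1) + e)) (l + (v + 1) + e + 1)
      have c2 := Nat.choose_succ_succ (v + 1 + (l + (v + 1) + e)) (l + 1 + v)
      simp only [Nat.succ_eq_add_one] at c1 c2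
      ring_nf at h1 h c1 c2 ihe ⊢
      omega

end Counting

/-! ### Permutations avoiding 213 and 312 are the unimodal ones -/

section Unimodal

/-- The permutation `σ` increases up to position `j` and decreases from there on. -/
def IsUnimodalAt {n : ℕ} (σ : Equiv.Perm (Fin n)) (j : Fin n) : Prop :=
  StrictMonoOn σ (Set.Iic j) ∧ StrictAntiOn σ (Set.Ici j)

theorem containsPattern213_iff {n : ℕ} (σ : Equiv.Perm (Fin n)) :
    ContainsPattern σ pattern213 ↔ ∃ a b c, a < b ∧ b < c ∧ σ b < σ a ∧ σ a < σ c := by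
  constructor
  · rintro ⟨f, hf, h⟩
    refine ⟨f 0, f 1, f 2, hf (by decide), hf (by decide), ?_, ?_⟩
    · exact lt_of_not_ge fun h' => absurd ((h 0 1).1 h') (by decide)
    · exact lt_of_not_ge fun h' => absurd ((h 2 0).1 h') (by decide)
  · rintro ⟨a, b, c, hab, hbc, h1, h2⟩
    refine ⟨![a, b, c], ?_, ?_⟩
    · rw [Fin.strictMono_iff_lt_succ]
      intro i
      fin_cases i
      · exact hab
      · exact hbc
    · intro x y
      have h3 := h1.trans h2
      fin_cases x <;> fin_cases y <;>
        simp [pattern213, h1.le, h2.le, h3.le, h1, h2, h3]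

theorem containsPattern312_iff {n : ℕ} (σ : Equiv.Perm (Fin n)) :
    ContainsPattern σ pattern312 ↔ ∃ a b c, a < b ∧ b < c ∧ σ b < σ c ∧ σ c < σ a := by
  constructor
  · rintro ⟨f, hf, h⟩
    refine ⟨f 0, f 1, f 2, hf (by decide), hf (by decide), ?_, ?_⟩
    · exact lt_of_not_ge fun h' => absurd ((h 2 1).1 h') (by decide)
    · exact lt_of_not_ge fun h' => absurd ((h 0 2).1 h') (by decide)
  · rintro ⟨a, b, c, hab, hbc, h1, h2⟩
    refine ⟨![a, b, c], ?_, ?_⟩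
    · rw [Fin.strictMono_iff_lt_succ]
      intro i
      fin_cases i
      · exact hab
      · exact hbc
    · intro x y
      have h3 := h1.trans h2
      fin_cases x <;> fin_cases y <;>
        simp [pattern312, h1.le, h2.le, h3.le, h1, h2, h3]

/-- A triple whose middle entry is smallest is a 213 or a 312, according to which outer entry is
larger. -/
theorem avoids_iff_no_valley {n : ℕ} (σ : Equiv.Perm (Fin n)) :
    (∀ ρ ∈ ({pattern213, pattern312} : Set (Equiv.Perm (Fin 3))), AvoidsPattern σ ρ) ↔
      ∀ a b c, a < b → b < c → σ b < σ a → σ c < σ b := by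
  simp only [Set.mem_insert_iff, Set.mem_singleton_iff, forall_eq_or_imp, forall_eq,
    AvoidsPattern, containsPattern213_iff, containsPattern312_iff]
  constructor
  · rintro ⟨h1, h2⟩ a b c hab hbc hba
    by_contra! hcb
    have hbc' : σ b < σ c := lt_of_le_of_ne hcb fun h => hbc.ne (σ.injective h)
    rcases lt_trichotomy (σ a) (σ c) with h | h | h
    · exact h1 ⟨a, b, c, hab, hbc, hba, h⟩
    · exact (hab.trans hbc).ne (σ.injective h)
    · exact h2 ⟨a, b, c, hab, hbc, hbc', h⟩
  · intro h
    constructor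
    · rintro ⟨a, b, c, hab, hbc, h1, h2⟩
      exact absurd (h a b c hab hbc h1) (h1.trans h2).not_gt
    · rintro ⟨a, b, c, hab, hbc, h1, h2⟩
      exact absurd (h a b c hab hbc (h1.trans h2)) h1.not_gt

theorem no_valley_iff_isUnimodalAt {m : ℕ} (σ : Equiv.Perm (Fin (m + 1))) :
    (∀ a b c, a < b → b < c → σ b < σ a → σ c < σ b) ↔
      IsUnimodalAt σ (σ.symm (Fin.last m)) := by
  set j := σ.symm (Fin.last m) with hj
  have hσj : σ j = Fin.last m := by simp [hj]
  have hlt : ∀ {b}, b ≠ j → σ b < σ j := fun {b} hb => by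
    rw [hσj, Fin.lt_last_iff_ne_last, ← hσj]
    exact fun h => hb (σ.injective h)
  constructor
  · intro h
    constructor
    · intro a _ b hb hab
      rcases (show b ≤ j from hb).eq_or_lt with rfl | hbj
      · exact hlt hab.ne
      · by_contra! hba
        exact absurd (h a b j hab hbj (lt_of_le_of_ne hba fun e => hab.ne' (σ.injective e)))
          (hlt hbj.ne).not_gt
    · intro a ha b _ hab
      rcases (show j ≤ a from ha).eq_or_lt with rfl | hja
      · exact hlt hab.ne'
      · exact h j a b hja hab (hlt hja.ne')
  · rintro ⟨h1, h2⟩ a b c hab hbc hba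
    rcases le_total b j with hb | hb
    · exact absurd (h1 (hab.le.trans hb) hb hab) hba.not_gt
    · exact h2 hb (hb.trans hbc.le) hbc

theorem IsUnimodalAt.apply_eq_last {m : ℕ} {σ : Equiv.Perm (Fin (m + 1))} {j : Fin (m + 1)}
    (h : IsUnimodalAt σ j) : σ j = Fin.last m := by
  rw [← Fin.last_le_iff]
  obtain ⟨i, hi⟩ := σ.surjective (Fin.last m)
  rw [← hi]
  rcases le_total i j with hij | hij
  · exact h.1.monotoneOn hij (Set.mem_Iic.2 le_rfl) hij
  · exact h.2.antitoneOn (Set.mem_Ici.2 le_rfl) hij hij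

theorem IsUnimodalAt.eq_symm_last {m : ℕ} {σ : Equiv.Perm (Fin (m + 1))} {j : Fin (m + 1)}
    (h : IsUnimodalAt σ j) : σ.symm (Fin.last m) = j := by
  rw [← h.apply_eq_last, Equiv.symm_apply_apply]

/-- A set has only one increasing and one decreasing enumeration. -/
theorem IsUnimodalAt.eq_of_image_eq {n : ℕ} {σ τ : Equiv.Perm (Fin n)} {j : Fin n}
    (hσ : IsUnimodalAt σ j) (hτ : IsUnimodalAt τ j)
    (h : σ '' Set.Iio j = τ '' Set.Iio j) : σ = τ := by
  have hc : σ '' Set.Ici j = τ '' Set.Ici j := by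
    rw [← Set.compl_Iio, Set.image_compl_eq σ.bijective, Set.image_compl_eq τ.bijective, h]
  have hmono : ∀ {ρ : Equiv.Perm (Fin n)}, IsUnimodalAt ρ j →
      StrictMono (fun x : Set.Iio j => ρ x) := fun hρ x y hxy =>
    hρ.1 (Set.Iio_subset_Iic_self x.prop) (Set.Iio_subset_Iic_self y.prop) hxy
  have hanti : ∀ {ρ : Equiv.Perm (Fin n)}, IsUnimodalAt ρ j →
      StrictAnti (fun x : Set.Ici j => ρ x) := fun hρ x y hxy => hρ.2 x.prop y.prop hxy
  have h1 := ((hmono hσ).range_inj (hmono hτ)).1 (by simpa only [Set.image_eq_range] using h)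
  have h2 := ((hanti hσ).range_inj (hanti hτ)).1 (by simpa only [Set.image_eq_range] using hc)
  ext i
  rcases lt_or_ge i j with hi | hi
  · exact congrArg Fin.val (congrFun h1 ⟨i, hi⟩)
  · exact congrArg Fin.val (congrFun h2 ⟨i, hi⟩)

theorem exists_isUnimodalAt {m : ℕ} (j : Fin (m + 1)) (s : Finset (Fin (m + 1)))
    (hs : s.card = j) (hlast : Fin.last m ∉ s) :
    ∃ σ : Equiv.Perm (Fin (m + 1)), IsUnimodalAt σ j ∧ σ '' Set.Iio j = s := by
  have hsc : sᶜ.card = m + 1 - j := by rw [Finset.card_compl, hs, Fintype.card_fin]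
  have hj : (j : ℕ) + (m + 1 - j) = m + 1 := by omega
  let e : Fin (m + 1) ≃ Fin j ⊕ Fin (m + 1 - j) := (finCongr hj.symm).trans finSumFinEquiv.symm
  let σ : Equiv.Perm (Fin (m + 1)) :=
    e.trans ((Equiv.sumCongr (Equiv.refl _) Fin.revPerm).trans (finSumEquivOfFinset hs hsc))
  have el : ∀ (i : Fin (m + 1)) (hi : i < j), e i = Sum.inl ⟨i, hi⟩ := fun i hi => by
    simp only [e, Equiv.trans_apply, Equiv.symm_apply_eq]
    ext; simp
  have er : ∀ (i : Fin (m + 1)) (hi : j ≤ i), e i = Sum.inr ⟨i - j, by omega⟩ := fun i hi => by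
    simp only [e, Equiv.trans_apply, Equiv.symm_apply_eq]
    ext; simp; omega
  have σl : ∀ (i : Fin (m + 1)) (hi : i < j), σ i = s.orderEmbOfFin hs ⟨i, hi⟩ := fun i hi => by
    simp [σ, el i hi]
  have σr : ∀ (i : Fin (m + 1)) (hi : j ≤ i),
      σ i = sᶜ.orderEmbOfFin hsc (Fin.rev ⟨i - j, by omega⟩) := fun i hi => by
    simp [σ, er i hi]
  have himage : σ '' Set.Iio j = s := by
    rw [← Finset.range_orderEmbOfFin s hs]
    ext x
    constructor
    · rintro ⟨i, hi, rfl⟩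
      exact ⟨_, (σl i hi).symm⟩
    · rintro ⟨i, rfl⟩
      exact ⟨⟨i, by omega⟩, i.2, σl ⟨i, by omega⟩ i.2⟩
  have hanti : StrictAntiOn σ (Set.Ici j) := by
    intro a ha b hb hab
    rw [σr a ha, σr b hb]
    apply (sᶜ.orderEmbOfFin hsc).strictMono
    rw [Fin.rev_lt_rev, Fin.mk_lt_mk]
    have : j ≤ a := ha
    omega
  -- The maximum lies outside `s`, hence in the decreasing part, which starts with its largest
  -- value.
  have hσj : σ j = Fin.last m := by
    obtain ⟨i, hi⟩ := σ.surjective (Fin.last m)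
    rcases lt_or_ge i j with hij | hij
    · refine absurd ?_ hlast
      rw [← Finset.mem_coe, ← himage, ← hi]
      exact ⟨i, hij, rfl⟩
    · rw [← Fin.last_le_iff, ← hi]
      exact hanti.antitoneOn (Set.mem_Ici.2 le_rfl) hij hij
  refine ⟨σ, ⟨?_, hanti⟩, himage⟩
  intro a _ b hb hab
  rcases (show b ≤ j from hb).eq_or_lt with rfl | hbj
  · rw [hσj, Fin.lt_last_iff_ne_last, ← hσj]
    exact fun h => hab.ne (σ.injective h)
  · rw [σl a (hab.trans hbj), σl b hbj]
    exact (s.orderEmbOfFin hs).strictMono hab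

theorem card_isUnimodalAt {m : ℕ} (j : Fin (m + 1)) :
    Nat.card {σ : Equiv.Perm (Fin (m + 1)) // IsUnimodalAt σ j} = m.choose j := by
  have hcard : Nat.card {s // s ∈ ((Finset.univ.erase (Fin.last m)).powersetCard j)} =
      m.choose j := by
    rw [Nat.card_eq_fintype_card, Fintype.card_coe, Finset.card_powersetCard,
      Finset.card_erase_of_mem (Finset.mem_univ _), Finset.card_univ, Fintype.card_fin,
      Nat.add_sub_cancel]
  rw [← hcard]
  refine Nat.card_eq_of_bijective (fun σ => ⟨(Finset.Iio j).map σ.1.toEmbedding, ?_⟩) ⟨?_, ?_⟩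
  · rw [Finset.mem_powersetCard]
    refine ⟨fun x hx => ?_, by simp⟩
    obtain ⟨i, hi, rfl⟩ := Finset.mem_map.1 hx
    rw [Finset.mem_erase, ← σ.2.apply_eq_last]
    exact ⟨fun h => (Finset.mem_Iio.1 hi).ne (σ.1.injective h), Finset.mem_univ _⟩
  · intro σ τ h
    refine Subtype.ext (σ.2.eq_of_image_eq τ.2 ?_)
    have := congrArg (fun s : Finset (Fin (m + 1)) => (s : Set (Fin (m + 1)))) (congrArg Subtype.val h)
    simpa using this
  · rintro ⟨s, hs⟩
    rw [Finset.mem_powersetCard] at hs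
    obtain ⟨σ, hσ, h⟩ := exists_isUnimodalAt j s hs.2
      fun h => (Finset.mem_erase.1 (hs.1 h)).1 rfl
    refine ⟨⟨σ, hσ⟩, Subtype.ext ?_⟩
    rw [← Finset.coe_inj, ← h]
    simp

end Unimodal

/-! ### Dyck paths by their final single north steps -/

section FinalSingles

open DyckStep

theorem count_take_succ_of_getElem? {L : List DyckStep} {j : ℕ} (h : L[j]? = some U) :
    (L.take (j + 1)).count U = (L.take j).count U + 1 := by
  rw [List.take_add_one, h]
  simp

/-- Singleness fails among the last `l` north steps exactly when some adjacent pair has its second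
member there; the count up to `j + 1` is the index of that second member. -/
theorem finalNorthStepsSingle_iff (p : DyckWord) (l : ℕ) :
    FinalNorthStepsSingle p l ↔ ∀ j, p.toList[j]? = some U → p.toList[j + 1]? = some U →
      (p.toList.take (j + 1)).count U + l < p.semilength := by
  constructor
  · intro h j h1 h2
    by_contra! h3
    exact (h (j + 1) h2 h3).2.2 j rfl h1
  · intro h j hj hl
    refine ⟨hj, fun h' => ?_, ?_⟩
    · have := h j hj h'
      rw [count_take_succ_of_getElem? hj] at this
      omega
    · rintro i rfl hi
      have := h i hi hj
      omega

theorem FinalNorthStepsSingle.mono {p : DyckWord} {k l : ℕ} (hkl : k ≤ l)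
    (h : FinalNorthStepsSingle p l) : FinalNorthStepsSingle p k :=
  fun j hj hk => h j hj (by omega)

theorem finalNorthStepsSingle_iff_isSparseSuffix (p : DyckWord) (l : ℕ) :
    FinalNorthStepsSingle p l ↔ IsSparseSuffix l p.toList := by
  have hsplit : ∀ (s : DyckStep) (i : ℕ),
      (p.toList.take i).count s + (p.toList.drop i).count s = p.toList.count s := fun s i => by
    rw [← List.count_append, List.take_append_drop]
  rw [finalNorthStepsSingle_iff, IsSparseSuffix.iff_drop, and_iff_right]
  · refine forall_congr' fun j => imp_congr_right fun _ => imp_congr_right fun _ => ?_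
    have := hsplit U (j + 1)
    rw [DyckWord.semilength]
    omega
  · intro i
    have h1 := hsplit U i
    have h2 := hsplit D i
    have h3 := p.count_U_eq_count_D
    have h4 := p.count_D_le_count_U i
    omega

theorem card_finalNorthStepsSingle (n l : ℕ) :
    Nat.card {p : DyckWord // p.semilength = n ∧ FinalNorthStepsSingle p l} =
      (sparseSuffixes l n n).ncard := by
  rw [← Nat.card_coe_set_eq]
  refine Nat.card_eq_of_bijective (fun p => ⟨p.1.toList, ?_, p.2.1, ?_⟩) ⟨?_, ?_⟩
  · exact (finalNorthStepsSingle_iff_isSparseSuffix _ _).1 p.2.2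
  · rw [← p.1.count_U_eq_count_D]
    exact p.2.1
  · intro p q h
    exact Subtype.ext (DyckWord.ext (congrArg Subtype.val h))
  · rintro ⟨L, hL, hu, hd⟩
    refine ⟨⟨⟨L, hu.trans hd.symm, fun i => ?_⟩, hu, ?_⟩, rfl⟩
    · have h := ((IsSparseSuffix.iff_drop l L).1 hL).1 i
      have hU : (L.take i).count U + (L.drop i).count U = L.count U := by
        rw [← List.count_append, List.take_append_drop]
      have hD : (L.take i).count D + (L.drop i).count D = L.count D := by
        rw [← List.count_append, List.take_append_drop]
      omega
    · rw [finalNorthStepsSingle_iff_isSparseSuffix]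
      exact hL

theorem card_finalNorthStepsSingle_add_choose {n l : ℕ} (h : l < n) :
    Nat.card {p : DyckWord // p.semilength = n ∧ FinalNorthStepsSingle p l} +
      (2 * n - 1 - l).choose (n + 1) = (2 * n - 1 - l).choose n := by
  obtain ⟨v, rfl⟩ := Nat.exists_eq_add_of_lt h
  have := ncard_sparseSuffixes_add_choose l v 1
  rwa [show l + 1 + v = l + v + 1 by omega,
    show v + (l + v + 1) = 2 * (l + v + 1) - 1 - l by omega, ← card_finalNorthStepsSingle] at this

theorem finite_dyckWord_semilength_and (n : ℕ) (P : DyckWord → Prop) :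
    Finite {p : DyckWord // p.semilength = n ∧ P p} :=
  Finite.of_injective (β := {p : DyckWord // p.semilength = n}) (fun p => ⟨p.1, p.2.1⟩)
    fun _ _ h => Subtype.ext (by simpa using h)

theorem isGreatest_finalNorthStepsSingle_iff (p : DyckWord) {n k : ℕ} (hk : k < n) :
    IsGreatest {l : ℕ | l < n ∧ FinalNorthStepsSingle p l} k ↔
      FinalNorthStepsSingle p k ∧ ¬ (k + 1 < n ∧ FinalNorthStepsSingle p (k + 1)) := by
  constructor
  · rintro ⟨⟨-, h1⟩, h2⟩
    exact ⟨h1, fun h => absurd (h2 h) (by omega)⟩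
  · rintro ⟨h1, h2⟩
    refine ⟨⟨hk, h1⟩, ?_⟩
    rintro l ⟨hl, h⟩
    by_contra! hkl
    exact h2 ⟨by omega, h.mono hkl⟩

theorem numDyckFinalSingles_add_card {n k : ℕ} (hk : k + 1 < n) :
    numDyckFinalSingles n k +
        Nat.card {p : DyckWord // p.semilength = n ∧ FinalNorthStepsSingle p (k + 1)} =
      Nat.card {p : DyckWord // p.semilength = n ∧ FinalNorthStepsSingle p k} := by
  have hcard : ∀ P : DyckWord → Prop, Nat.card {p : DyckWord // p.semilength = n ∧ P p} =
      {p : DyckWord | p.semilength = n ∧ P p}.ncard := fun P => Nat.card_coe_set_eq _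
  have hfin : ∀ P : DyckWord → Prop, {p : DyckWord | p.semilength = n ∧ P p}.Finite :=
    fun P => finite_dyckWord_semilength_and n P
  rw [numDyckFinalSingles, hcard, hcard, hcard, ← Set.ncard_union_eq _ (hfin _) (hfin _)]
  · congr 1
    ext p
    simp only [Set.mem_union, Set.mem_ofPred_eq,
      isGreatest_finalNorthStepsSingle_iff p (by omega : k < n)]
    have := FinalNorthStepsSingle.mono (p := p) (Nat.le_succ k)
    simp only [Nat.succ_eq_add_one] at this
    tauto
  · rw [Set.disjoint_left]
    rintro p ⟨-, hp⟩ ⟨-, hp'⟩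
    rw [isGreatest_finalNorthStepsSingle_iff p (by omega)] at hp
    exact hp.2 ⟨hk, hp'⟩

theorem numDyckFinalSingles_last (m : ℕ) :
    numDyckFinalSingles (m + 1) m =
      Nat.card {p : DyckWord // p.semilength = m + 1 ∧ FinalNorthStepsSingle p m} := by
  simp only [numDyckFinalSingles, isGreatest_finalNorthStepsSingle_iff _ (Nat.lt_succ_self m),
    lt_irrefl, false_and, not_false_eq_true, and_true]

theorem cast_numDyckFinalSingles {n k : ℕ} (hk : k < n) :
    (numDyckFinalSingles n k : ℚ) =
      ((k : ℚ) + 1) * ((2 * n - 2 - k).choose (n - 1 - k) : ℚ) / (n : ℚ) := by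
  obtain ⟨r, rfl⟩ := Nat.exists_eq_add_of_lt hk
  have hsymm : (2 * (k + r + 1) - 2 - k).choose (k + r + 1 - 1 - k) =
      (k + r + r).choose (k + r) := by
    rw [Nat.choose_symm_add]
    congr 1 <;> omega
  rw [hsymm, eq_div_iff (by positivity)]
  have h1 := card_finalNorthStepsSingle_add_choose hk
  rcases r with _ | r
  · have h2 := numDyckFinalSingles_last k
    simp only [add_zero] at *
    rw [h2]
    have e : 2 * (k + 1) - 1 - k = k + 1 := by omega
    rw [e, Nat.choose_self, Nat.choose_eq_zero_of_lt (by omega : k + 1 < k + 1 + 1)] at h1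
    simp only [add_zero] at h1
    rw [h1]
    simp
  · have h2 := numDyckFinalSingles_add_card (n := k + (r + 1) + 1) (k := k) (by omega)
    have h3 := card_finalNorthStepsSingle_add_choose
      (by omega : k + 1 < k + (r + 1) + 1)
    have e1 : 2 * (k + (r + 1) + 1) - 1 - k = (k + (r + 1) + (r + 1)) + 1 := by omega
    have e2 : 2 * (k + (r + 1) + 1) - 1 - (k + 1) = k + (r + 1) + (r + 1) := by omega
    rw [e1] at h1
    rw [e2] at h3
    have c1 := Nat.choose_succ_succ (k + (r + 1) + (r + 1)) (k + (r + 1))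
    have c2 := Nat.choose_succ_succ (k + (r + 1) + (r + 1)) (k + (r + 1) + 1)
    -- With `M = 2n - 2 - k`, this is `C(M, n) * n = C(M, n-1) * (n-1-k)`, which turns `C(M, n-1) -
    -- C(M, n)` into `(k+1) / n * C(M, n-1)`.
    have c3 := Nat.choose_succ_right_eq (k + (r + 1) + (r + 1)) (k + (r + 1))
    rw [Nat.add_sub_cancel_left] at c3
    simp only [Nat.succ_eq_add_one] at c1 c2
    have key : numDyckFinalSingles (k + (r + 1) + 1) k +
        (k + (r + 1) + (r + 1)).choose (k + (r + 1) + 1) =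
        (k + (r + 1) + (r + 1)).choose (k + (r + 1)) := by omega
    have key' : (numDyckFinalSingles (k + (r + 1) + 1) k : ℚ) +
        ((k + (r + 1) + (r + 1)).choose (k + (r + 1) + 1) : ℚ) =
        ((k + (r + 1) + (r + 1)).choose (k + (r + 1)) : ℚ) := by exact_mod_cast key
    have c3' : ((k + (r + 1) + (r + 1)).choose (k + (r + 1) + 1) : ℚ) *
        ((k : ℚ) + (r + 1) + 1) = ((k + (r + 1) + (r + 1)).choose (k + (r + 1)) : ℚ) *
          ((r : ℚ) + 1) := by exact_mod_cast c3
    push_cast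
    linear_combination ((k : ℚ) + (r + 1) + 1) * key' - c3'

/-- Telescoping of `numDyckFinalSingles_add_card`, ending at `k = n - 1`, where no larger value
competes. -/
theorem card_finalNorthStepsSingle_eq_sum {n i : ℕ} (hi : i < n) :
    Nat.card {p : DyckWord // p.semilength = n ∧ FinalNorthStepsSingle p i} =
      ∑ k ∈ Finset.Ico i n, numDyckFinalSingles n k := by
  obtain ⟨r, rfl⟩ := Nat.exists_eq_add_of_lt hi
  induction r generalizing i with
  | zero => simp [numDyckFinalSingles_last]
  | succ r ih =>
    rw [Finset.sum_eq_sum_Ico_succ_bot (by omega), ← numDyckFinalSingles_add_card (by omega)]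
    have h := ih (i := i + 1) (by omega)
    rw [show i + 1 + r + 1 = i + (r + 1) + 1 by omega] at h
    rw [h]

end FinalSingles

/-! ### Combining unimodal labelings with Dyck paths -/

section ParkingFunctions

open DyckStep

/-- The labeling condition on the north steps of a Dyck path, as in `LabeledDyckPath`. -/
def IncreasesOnRuns {n : ℕ} (p : DyckWord) (σ : Equiv.Perm (Fin n)) : Prop :=
  ∀ (j : ℕ) (a b : Fin n), p.toList[j]? = some U → p.toList[j + 1]? = some U →
    (p.toList.take j).count U = (a : ℕ) → (p.toList.take (j + 1)).count U = (b : ℕ) → σ a < σ b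

/-- For adjacent north steps numbered `a` and `a + 1`, unimodality gives an ascent exactly when `a +
1 ≤ i`, i.e. when the second is not among the last `m - i`. -/
theorem increasesOnRuns_iff {m : ℕ} {p : DyckWord} (hp : p.semilength = m + 1)
    {σ : Equiv.Perm (Fin (m + 1))} {i : Fin (m + 1)} (hσ : IsUnimodalAt σ i) :
    IncreasesOnRuns p σ ↔ FinalNorthStepsSingle p (m - i) := by
  rw [finalNorthStepsSingle_iff, hp]
  refine forall_congr' fun j => ?_
  constructor
  · intro h h1 h2
    have h3 := count_take_succ_of_getElem? h1
    have h4 := count_take_succ_of_getElem? h2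
    have h5 : (p.toList.take (j + 1 + 1)).count U ≤ m + 1 :=
      hp ▸ (List.take_sublist _ _).count_le U
    have h6 := h ⟨(p.toList.take j).count U, by omega⟩ ⟨(p.toList.take (j + 1)).count U, by omega⟩
      h1 h2 rfl rfl
    by_contra! h7
    refine h6.not_gt (hσ.2 ?_ ?_ ?_)
    · simp only [Set.mem_Ici, Fin.le_def]; omega
    · simp only [Set.mem_Ici, Fin.le_def]; omega
    · simp only [Fin.lt_def]; omega
  · intro h a b h1 h2 ha hb
    have h3 := count_take_succ_of_getElem? h1
    have h4 := h h1 h2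
    refine hσ.1 ?_ ?_ ?_
    · simp only [Set.mem_Iic, Fin.le_def]; omega
    · simp only [Set.mem_Iic, Fin.le_def]; omega
    · simp only [Fin.lt_def]; omega

/-- A parking function whose permutation is unimodal consists of a position of the maximum, a
permutation with its maximum there, and a Dyck path which ends in sufficiently many single north
steps. -/
def unimodalParkingEquiv (m : ℕ) :
    {p : LabeledDyckPath (m + 1) // ∀ ρ ∈ ({pattern213, pattern312} : Set (Equiv.Perm (Fin 3))),
      AvoidsPattern p.label ρ} ≃
    Σ i : Fin (m + 1), {σ : Equiv.Perm (Fin (m + 1)) // IsUnimodalAt σ i} ×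
      {p : DyckWord // p.semilength = m + 1 ∧ FinalNorthStepsSingle p (m - i)} where
  toFun p :=
    have h := (no_valley_iff_isUnimodalAt _).1 ((avoids_iff_no_valley _).1 p.2)
    ⟨p.1.label.symm (Fin.last m), ⟨p.1.label, h⟩,
      ⟨p.1.path, p.1.semilength_path, (increasesOnRuns_iff p.1.semilength_path h).1 p.1.label_lt⟩⟩
  invFun x :=
    ⟨⟨x.2.2.1, x.2.2.2.1, x.2.1.1, (increasesOnRuns_iff x.2.2.2.1 x.2.1.2).2 x.2.2.2.2⟩,
      (avoids_iff_no_valley _).2 ((no_valley_iff_isUnimodalAt _).2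
        (x.2.1.2.eq_symm_last.symm ▸ x.2.1.2))⟩
  left_inv _ := rfl
  right_inv := by
    rintro ⟨i, ⟨σ, hσ⟩, ⟨p, hp⟩⟩
    obtain rfl := hσ.eq_symm_last
    rfl

theorem pf_eq_sum_card (m : ℕ) :
    pf (m + 1) {pattern213, pattern312} = ∑ i ∈ Finset.range (m + 1), m.choose i *
      Nat.card {p : DyckWord // p.semilength = m + 1 ∧ FinalNorthStepsSingle p i} := by
  have hfin := fun P => finite_dyckWord_semilength_and (m + 1) P
  -- The reflection `i ↦ m - i` passes from the peak position to the length of the descent after it.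
  rw [pf, Nat.card_congr (unimodalParkingEquiv m), Nat.card_sigma, ← Finset.sum_range_reflect,
    ← Fin.sum_univ_eq_sum_range (fun i => m.choose (m + 1 - 1 - i) * Nat.card {p : DyckWord //
      p.semilength = m + 1 ∧ FinalNorthStepsSingle p (m + 1 - 1 - i)})]
  refine Finset.sum_congr rfl fun i _ => ?_
  rw [Nat.card_prod, card_isUnimodalAt, Nat.add_sub_cancel, Nat.choose_symm (by omega)]

end ParkingFunctions

theorem theoremT (n : ℕ) (hn : 1 ≤ n) :
    ((pf n {pattern213, pattern312} : ℕ) : ℚ) =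
        ∑ k ∈ Finset.range n, ∑ i ∈ Finset.range (k + 1),
          ((n - 1).choose i : ℚ) *
            (((k : ℚ) + 1) * ((2 * n - 2 - k).choose (n - 1 - k) : ℚ) / (n : ℚ)) ∧
      ∀ k : ℕ, k < n →
        ((numDyckFinalSingles n k : ℕ) : ℚ) =
          ((k : ℚ) + 1) * ((2 * n - 2 - k).choose (n - 1 - k) : ℚ) / (n : ℚ) := by
  refine ⟨?_, fun k hk => cast_numDyckFinalSingles hk⟩
  obtain ⟨m, rfl⟩ := Nat.exists_eq_add_of_le' hn
  have hsum : pf (m + 1) {pattern213, pattern312} = ∑ k ∈ Finset.range (m + 1),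
      ∑ i ∈ Finset.range (k + 1), m.choose i * numDyckFinalSingles (m + 1) k := by
    rw [pf_eq_sum_card]
    have h : ∀ i ∈ Finset.range (m + 1), m.choose i *
        Nat.card {p : DyckWord // p.semilength = m + 1 ∧ FinalNorthStepsSingle p i} =
        ∑ k ∈ Finset.Ico i (m + 1), m.choose i * numDyckFinalSingles (m + 1) k := fun i hi => by
      rw [card_finalNorthStepsSingle_eq_sum (Finset.mem_range.1 hi), Finset.mul_sum]
    rw [Finset.sum_congr rfl h]
    -- Both orders sum over the triangle `i ≤ k ≤ m`.
    refine Finset.sum_comm' fun i k => ?_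
    simp only [Finset.mem_range, Finset.mem_Ico]
    omega
  rw [hsum]
  push_cast
  refine Finset.sum_congr rfl fun k hk => Finset.sum_congr rfl fun i _ => ?_
  rw [cast_numDyckFinalSingles (Finset.mem_range.1 hk), Nat.add_sub_cancel]
  push_cast
  rfl
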